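/- **Theorem 2.2.** Let $x$ be a real number with $|x|<1$ and let $\mathbf{k}=(k_1,\ldots,k_r)$ be an index, i.e. a finite (possibly empty) sequence of positive integers. For positive integers $N$ and real $0<t<1$ put $$\zeta_N^{(x)}(\mathbf{k})=\sum_{0<m_1<\cdots<m_r<N}\frac1{(m_1+x)^{k_1}\cdots(m_r+x)^{k_r}},\qquad \mathrm{Li}_{\mathbf{k}}^{(x)}(t)=\sum_{0<m_1<\cdots<m_r}\frac{t^{m_r+x}}{(m_1+x)^{k_1}\cdots(m_r+x)^{k_r}},$$ both understood as $1$ if $r=0$. Let $\psi=\Gamma'/\Gamma$ be the digamma function and $\gamma$ Euler's constant. Then there are unique polynomials $Z_*^{(x)}(\mathbf{k};T)$ and $P^{(x)}(\mathbf{k};T)$ in $\mathbb{R}[T]$ such that, for some integer $p>0$, $$\zeta_N^{(x)}(\mathbf{k})=Z_*^{(x)}\bigl(\mathbf{k};\log N-\psi(1+x)\bigr)+O\bigl(N^{-1}\log^pN\bigr)\quad(N\to\infty)$$ and, for some integer $p>0$, $$\mathrm{Li}_{\mathbf{k}}^{(x)}(t)=P^{(x)}\bigl(\mathbf{k};-\log(1-t)\bigr)+O\bigl((1-t)\log^p(1-t)\bigr)\quad(t\to1^-),$$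 and they satisfy $$P^{(x)}(\mathbf{k};T)=\rho\bigl(Z_*^{(x)}(\mathbf{k};T-\gamma-\psi(1+x))\bigr).$$ Here $\rho:\mathbb{R}[T]\to\mathbb{R}[T]$ is the $\mathbb{R}$-linear map determined by $\rho(e^{Ty})=A(y)e^{Ty}$ in $\mathbb{R}[T][[y]]$, where $\rho$ acts coefficientwise in $y$ and $A(y)\in\mathbb{R}[[y]]$ is the Taylor series at $y=0$ of $e^{\gamma y}\Gamma(1+y)$. -/

import Mathlib

namespace HurwitzMZV

open Polynomial Filter Topology Asymptotics

/-- The digamma function `ψ = Γ'/Γ` of a real variable. -/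
noncomputable def digamma (s : ℝ) : ℝ := deriv Real.Gamma s / Real.Gamma s

open Classical in
/-- `ζ_N^{(x)}(k₁,…,k_r) = ∑_{0 < m₁ < ⋯ < m_r < N} ∏ᵢ (mᵢ + x)^{-kᵢ}`; the value is `1` if `r = 0`. -/
noncomputable def zetaTrunc (x : ℝ) {r : ℕ} (k : Fin r → ℕ+) (N : ℕ) : ℝ :=
  ∑ m ∈ (Fintype.piFinset fun _ : Fin r => Finset.Ioo 0 N).filter StrictMono,
    1 / ∏ i, ((m i : ℝ) + x) ^ (k i : ℕ)

/-- `Li^{(x)}_{k₁,…,k_r}(t) = ∑_{0 < m₁ < ⋯ < m_r} t^{m_r + x} ∏ᵢ (mᵢ + x)^{-kᵢ}`, and `1` if `r = 0`.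
For `|x| < 1` and `0 < t < 1` this is a convergent series of positive terms. -/
noncomputable def hurwitzLi (x : ℝ) : {r : ℕ} → (Fin r → ℕ+) → ℝ → ℝ
  | 0, _, _ => 1
  | r + 1, k, t =>
    ∑' m : {m : Fin (r + 1) → ℕ // StrictMono m ∧ ∀ i, 0 < m i},
      t ^ ((m.1 (Fin.last r) : ℝ) + x) / ∏ i, ((m.1 i : ℝ) + x) ^ (k i : ℕ)

/-- `Z` describes the divergence of `ζ_N^{(x)}(k)`: for some `p > 0`,
`ζ_N^{(x)}(k) = Z(log N - ψ(1+x)) + O(N⁻¹ log^p N)` as `N → ∞`. -/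
def IsSeriesReg (x : ℝ) {r : ℕ} (k : Fin r → ℕ+) (Z : ℝ[X]) : Prop :=
  ∃ p : ℕ, 0 < p ∧
    (fun N : ℕ => zetaTrunc x k N - Z.eval (Real.log N - digamma (1 + x)))
      =O[atTop] fun N : ℕ => (N : ℝ)⁻¹ * Real.log N ^ p

/-- `P` describes the divergence of `Li^{(x)}_k(t)`: for some `p > 0`,
`Li^{(x)}_k(t) = P(-log(1-t)) + O((1-t) log^p(1-t))` as `t → 1` from below. -/
def IsIntegralReg (x : ℝ) {r : ℕ} (k : Fin r → ℕ+) (P : ℝ[X]) : Prop :=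
  ∃ p : ℕ, 0 < p ∧
    (fun t : ℝ => hurwitzLi x k t - P.eval (-Real.log (1 - t)))
      =O[𝓝[<] 1] fun t : ℝ => (1 - t) * Real.log (1 - t) ^ p

/-- The polynomial `Z_*^{(x)}(k; T)` characterized by `IsSeriesReg`. -/
noncomputable def seriesRegPoly (x : ℝ) {r : ℕ} (k : Fin r → ℕ+) : ℝ[X] :=
  Classical.epsilon (IsSeriesReg x k)

/-- The polynomial `P^{(x)}(k; T)` characterized by `IsIntegralReg`. -/
noncomputable def integralRegPoly (x : ℝ) {r : ℕ} (k : Fin r → ℕ+) : ℝ[X] :=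
  Classical.epsilon (IsIntegralReg x k)

/-- The Taylor series at `y = 0` of `A(y) = e^{γ y} Γ(1 + y)`. -/
noncomputable def gammaSeries : PowerSeries ℝ :=
  PowerSeries.mk fun n =>
    iteratedDeriv n
      (fun y : ℝ => Real.exp (Real.eulerMascheroniConstant * y) * Real.Gamma (1 + y)) 0
      / (n.factorial : ℝ)

/-- The series `e^{Ty} = ∑ₙ (Tⁿ / n!) yⁿ` in `ℝ[T]⟦y⟧`. -/
noncomputable def expTy : PowerSeries ℝ[X] :=
  PowerSeries.mk fun n => monomial n ((n.factorial : ℝ)⁻¹)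

/-- The `ℝ`-linear map `ρ` on `ℝ[T]` with `ρ(e^{Ty}) = A(y) e^{Ty}`: the image of `Tⁿ` is `n!` times
the coefficient of `yⁿ` in `A(y) e^{Ty}`. -/
noncomputable def rho : ℝ[X] →ₗ[ℝ] ℝ[X] :=
  (basisMonomials ℝ).constr ℝ fun n =>
    (n.factorial : ℝ) • PowerSeries.coeff n (PowerSeries.map C gammaSeries * expTy)

/-- `rho` is the only linear map that, applied coefficientwise, sends `e^{Ty}` to `A(y) e^{Ty}`. -/
theorem eq_rho_iff (f : ℝ[X] →ₗ[ℝ] ℝ[X]) :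
    f = rho ↔ (PowerSeries.mk fun n => f (PowerSeries.coeff n expTy))
      = PowerSeries.map C gammaSeries * expTy := by
  have key : ∀ (g : ℝ[X] →ₗ[ℝ] ℝ[X]) (n : ℕ),
      g (monomial n 1) = (n.factorial : ℝ) • g (PowerSeries.coeff n expTy) := by
    intro g n
    have h : (n.factorial : ℝ) ≠ 0 := by positivity
    rw [← map_smul, expTy, PowerSeries.coeff_mk, smul_monomial, smul_eq_mul, mul_inv_cancel₀ h]
  have hrho : ∀ n : ℕ, rho (monomial n 1) =
      (n.factorial : ℝ) • PowerSeries.coeff n (PowerSeries.map C gammaSeries * expTy) := by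
    intro n
    have h : monomial n (1 : ℝ) = basisMonomials ℝ n := by rw [coe_basisMonomials]
    rw [rho, h, Module.Basis.constr_basis]
  constructor
  · rintro rfl
    ext1 n
    have h : (n.factorial : ℝ) ≠ 0 := by positivity
    rw [PowerSeries.coeff_mk]
    exact smul_right_injective _ h ((key rho n).symm.trans (hrho n))
  · intro h
    refine (basisMonomials ℝ).ext fun n => ?_
    rw [coe_basisMonomials, hrho, key, ← h, PowerSeries.coeff_mk]

end HurwitzMZV

/-!
Summing over one index at a time gives an expansion `ζ_N = W(log N) + O(N⁻¹ log ^ p N)` with `W` a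
polynomial: the increments of `R(log N)`, where `R' = W`, match the terms `W(log N) / (N + x)` up to
a summable error. Both regularizations are read off from `W`: clearly `Z_*(T) = W(T + ψ(1 + x))`.
On the other side, `e^{-ms} = ℙ(V ≥ ms)` for an exponentially distributed `V`, so that
`Li(e^{-s}) = e^{-sx} 𝔼 ζ_{⌊V/s⌋ + 1}`, which up to `O(s log ^ q s)` is
`𝔼 W(log (V/s)) = 𝔼 W(-log s + log V)`. The moment generating function of `γ + log V` is
`e^{γy} Γ(1 + y)`, so `ρ` is averaging over the shift `T ↦ T + γ + log V` and the last expectation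
is `ρ(W(T - γ))` at `T = -log s`. Finally `s = -log t` is replaced by `1 - t`.
-/

namespace HurwitzMZV

open Polynomial Filter Topology Asymptotics Set MeasureTheory ProbabilityTheory

section SoftBigO

variable {α β : Type*} {l : Filter α} {L f g h f₁ f₂ g₁ g₂ : α → ℝ}

/-- Big-O up to powers of a gauge `L`, which will be a logarithm: `f = O(g L ^ p)` along `l` for
some exponent `p`. -/
def IsSoftBigO (l : Filter α) (L f g : α → ℝ) : Prop :=
  ∃ p : ℕ, f =O[l] fun a => g a * L a ^ p

theorem IsSoftBigO.of_isBigO (h : f =O[l] g) : IsSoftBigO l L f g :=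
  ⟨0, by simpa using h⟩

theorem IsSoftBigO.of_isBigO_mul (h : f =O[l] fun a => g a * L a) : IsSoftBigO l L f g :=
  ⟨1, by simpa using h⟩

theorem IsSoftBigO.trans (hfg : IsSoftBigO l L f g) (hgh : IsSoftBigO l L g h) :
    IsSoftBigO l L f h := by
  obtain ⟨p, hp⟩ := hfg
  obtain ⟨q, hq⟩ := hgh
  refine ⟨q + p, hp.trans ?_⟩
  simpa only [pow_add, mul_assoc] using hq.mul (isBigO_refl (fun a => L a ^ p) l)

theorem IsSoftBigO.mul (h₁ : IsSoftBigO l L f₁ g₁) (h₂ : IsSoftBigO l L f₂ g₂) :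
    IsSoftBigO l L (fun a => f₁ a * f₂ a) fun a => g₁ a * g₂ a := by
  obtain ⟨p, hp⟩ := h₁
  obtain ⟨q, hq⟩ := h₂
  refine ⟨p + q, (hp.mul hq).congr_right fun a => ?_⟩
  rw [pow_add, mul_mul_mul_comm]

theorem IsSoftBigO.congr_left (h : IsSoftBigO l L f₁ g) (hf : f₁ =ᶠ[l] f₂) :
    IsSoftBigO l L f₂ g :=
  h.imp fun _ hp => hp.congr' hf EventuallyEq.rfl

theorem IsSoftBigO.comp_tendsto {l' : Filter β} {φ : β → α} (h : IsSoftBigO l L f g)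
    (hφ : Tendsto φ l' l) : IsSoftBigO l' (L ∘ φ) (f ∘ φ) (g ∘ φ) :=
  h.imp fun _ hp => hp.comp_tendsto hφ

theorem IsSoftBigO.of_gauge_isBigO {L' : α → ℝ} (h : IsSoftBigO l L f g) (hL : L =O[l] L') :
    IsSoftBigO l L' f g :=
  h.imp fun p hp => hp.trans ((isBigO_refl g l).mul (hL.pow p))

theorem isBigO_mul_pow_of_le (hL : ∀ᶠ a in l, 1 ≤ |L a|) {p q : ℕ} (hpq : p ≤ q) :
    (fun a => g a * L a ^ p) =O[l] fun a => g a * L a ^ q := by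
  refine (isBigO_refl g l).mul (IsBigO.of_bound' ?_)
  filter_upwards [hL] with a ha
  simpa only [norm_pow, Real.norm_eq_abs] using pow_le_pow_right₀ ha hpq

theorem IsSoftBigO.exists_pos (h : IsSoftBigO l L f g) (hL : ∀ᶠ a in l, 1 ≤ |L a|) :
    ∃ p : ℕ, 0 < p ∧ f =O[l] fun a => g a * L a ^ p := by
  obtain ⟨p, hp⟩ := h
  exact ⟨p + 1, p.succ_pos, hp.trans (isBigO_mul_pow_of_le hL p.le_succ)⟩

theorem IsSoftBigO.add (h₁ : IsSoftBigO l L f₁ g) (h₂ : IsSoftBigO l L f₂ g)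
    (hL : ∀ᶠ a in l, 1 ≤ |L a|) : IsSoftBigO l L (fun a => f₁ a + f₂ a) g := by
  obtain ⟨p, hp⟩ := h₁
  obtain ⟨q, hq⟩ := h₂
  exact ⟨max p q, (hp.trans (isBigO_mul_pow_of_le hL (le_max_left p q))).add
    (hq.trans (isBigO_mul_pow_of_le hL (le_max_right p q)))⟩

theorem isSoftBigO_eval (Q : ℝ[X]) (hf : f =O[l] L) (hL : ∀ᶠ a in l, 1 ≤ |L a|) :
    IsSoftBigO l L (fun a => Q.eval (f a)) fun _ => 1 := by
  induction Q using Polynomial.induction_on' with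
  | add P Q hP hQ => simpa only [eval_add] using hP.add hQ hL
  | monomial n c =>
    exact ⟨n, by simpa only [eval_monomial, one_mul] using (hf.pow n).const_mul_left c⟩

theorem exists_eval_sub_eval_eq (Q : ℝ[X]) (a b : ℝ) :
    ∃ ξ, |ξ - b| ≤ |a - b| ∧ Q.eval a - Q.eval b = Q.derivative.eval ξ * (a - b) := by
  have mean_value : ∀ c d : ℝ, c < d →
      ∃ ξ ∈ Ioo c d, Q.derivative.eval ξ = (Q.eval d - Q.eval c) / (d - c) := fun c d hcd =>
    exists_hasDerivAt_eq_slope _ _ hcd Q.continuous.continuousOn fun ξ _ => Q.hasDerivAt ξ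
  rcases lt_trichotomy a b with hab | rfl | hab
  · obtain ⟨ξ, ⟨h₁, h₂⟩, hξ⟩ := mean_value a b hab
    refine ⟨ξ, ?_, ?_⟩
    · rw [abs_of_neg (sub_neg.2 h₂), abs_of_neg (sub_neg.2 hab)]
      linarith
    · rw [hξ]
      field_simp [sub_ne_zero.2 hab.ne']
      ring
  · exact ⟨a, le_rfl, by simp⟩
  · obtain ⟨ξ, ⟨h₁, h₂⟩, hξ⟩ := mean_value b a hab
    refine ⟨ξ, ?_, ?_⟩
    · rw [abs_of_pos (sub_pos.2 h₁), abs_of_pos (sub_pos.2 hab)]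
      linarith
    · rw [hξ, div_mul_cancel₀ _ (sub_ne_zero.2 hab.ne')]

theorem isSoftBigO_eval_sub_eval (Q : ℝ[X]) (hf : f =O[l] L) (hg : g =O[l] L)
    (hL : ∀ᶠ a in l, 1 ≤ |L a|) :
    IsSoftBigO l L (fun a => Q.eval (f a) - Q.eval (g a)) fun a => f a - g a := by
  choose ξ hξ hQ using fun a => exists_eval_sub_eval_eq Q (f a) (g a)
  have hξL : ξ =O[l] L := by
    have h : (fun a => ξ a - g a) =O[l] L := (IsBigO.of_bound' (.of_forall hξ)).trans (hf.sub hg)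
    simpa only [sub_add_cancel] using h.add hg
  simpa only [hQ, one_mul] using
    (isSoftBigO_eval Q.derivative hξL hL).mul (.of_isBigO (isBigO_refl (fun a => f a - g a) l))

end SoftBigO

section Summation

theorem exists_derivative_eq (Q : ℝ[X]) : ∃ R : ℝ[X], R.derivative = Q := by
  induction Q using Polynomial.induction_on' with
  | add P Q hP hQ =>
    obtain ⟨R, rfl⟩ := hP
    obtain ⟨S, rfl⟩ := hQ
    exact ⟨R + S, derivative_add⟩
  | monomial n c =>
    have hn : (n : ℝ) + 1 ≠ 0 := by positivity
    exact ⟨monomial (n + 1) (c / (n + 1)), by simp [hn]⟩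

theorem hasSum_telescope_of_antitone {b : ℕ → ℝ} (hb : ∀ n, b (n + 1) ≤ b n)
    (hb₀ : Tendsto b atTop (𝓝 0)) : HasSum (fun n => b n - b (n + 1)) (b 0) := by
  rw [hasSum_iff_tendsto_nat_of_nonneg fun n => sub_nonneg.2 (hb n)]
  simpa only [Finset.sum_range_sub', sub_zero] using hb₀.const_sub (b 0)

theorem exists_sum_range_sub_isBigO {a b : ℕ → ℝ} (hab : ∀ᶠ n in atTop, |a n| ≤ b n - b (n + 1))
    (hb : Tendsto b atTop (𝓝 0)) :
    ∃ c, (fun N => ∑ n ∈ Finset.range N, a n - c) =O[atTop] b := by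
  obtain ⟨N₀, hN₀⟩ := eventually_atTop.1 hab
  have tail_majorant : ∀ N ≥ N₀, HasSum (fun n => b (n + N) - b (n + N + 1)) (b N) := by
    intro N hN
    simpa only [zero_add, add_right_comm _ 1 N] using
      hasSum_telescope_of_antitone (b := fun n => b (n + N))
        (fun n => by
          rw [add_right_comm]
          exact sub_nonneg.1 ((abs_nonneg _).trans (hN₀ (n + N) (by omega))))
        ((tendsto_add_atTop_iff_nat N).2 hb)
  have hsum : Summable a := (summable_nat_add_iff N₀).1 <|
    (tail_majorant N₀ le_rfl).summable.of_norm_bounded fun n => hN₀ (n + N₀) (by omega)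
  refine ⟨∑' n, a n, IsBigO.of_bound' ?_⟩
  filter_upwards [eventually_ge_atTop N₀] with N hN
  rw [← hsum.sum_add_tsum_nat_add N, sub_add_cancel_left, norm_neg]
  exact (tsum_of_norm_bounded (tail_majorant N hN) fun n => hN₀ (n + N) (by omega)).trans
    (le_abs_self _)

theorem hasDerivAt_neg_inv_mul_log_pow (p : ℕ) {y : ℝ} (hy : y ≠ 0) :
    HasDerivAt (fun y : ℝ => -(y⁻¹ * Real.log y ^ p))
      ((Real.log y ^ p - p * Real.log y ^ (p - 1)) / y ^ 2) y := by
  refine ((hasDerivAt_inv hy).fun_mul ((Real.hasDerivAt_log hy).fun_pow p)).fun_neg.congr_deriv ?_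
  field_simp
  ring

theorem eventually_log_pow_div_sq_le (p : ℕ) : ∀ᶠ N : ℕ in atTop,
    (N : ℝ)⁻¹ ^ 2 * Real.log N ^ p ≤
      8 * ((N : ℝ)⁻¹ * Real.log N ^ p - ((N + 1 : ℕ) : ℝ)⁻¹ * Real.log (N + 1 : ℕ) ^ p) := by
  filter_upwards [(Real.tendsto_log_atTop.comp tendsto_natCast_atTop_atTop).eventually_ge_atTop
    (2 * p : ℝ), eventually_ge_atTop 1] with N hlog hN
  have hN' : (1 : ℝ) ≤ N := by exact_mod_cast hN
  obtain ⟨ξ, ⟨hNξ, hξN⟩, hξ⟩ := exists_hasDerivAt_eq_slope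
    (fun y : ℝ => -(y⁻¹ * Real.log y ^ p)) _ (lt_add_one (N : ℝ))
    (fun y hy => (hasDerivAt_neg_inv_mul_log_pow p
      (by linarith [hy.1])).continuousAt.continuousWithinAt)
    fun y hy => hasDerivAt_neg_inv_mul_log_pow p (by linarith [hy.1])
  have hlogξ : Real.log N ≤ Real.log ξ := Real.log_le_log (by linarith) hNξ.le
  have hpow : ∀ j, 0 ≤ Real.log ξ ^ j := pow_nonneg ((Real.log_nonneg hN').trans hlogξ)
  have half : Real.log ξ ^ p / 2 ≤ Real.log ξ ^ p - p * Real.log ξ ^ (p - 1) := by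
    rcases p with _ | p
    · norm_num
    · have hpξ : 2 * ((p + 1 : ℕ) : ℝ) ≤ Real.log ξ := hlog.trans hlogξ
      rw [pow_succ, Nat.add_sub_cancel]
      nlinarith [hpow p]
  rw [show ∀ u v : ℝ, (-v - -u) / ((N : ℝ) + 1 - N) = u - v from fun u v => by ring] at hξ
  push_cast
  rw [← hξ]
  calc (N : ℝ)⁻¹ ^ 2 * Real.log N ^ p
      = 8 * ((Real.log N ^ p / 2) / (2 * N) ^ 2) := by field_simp; norm_num
    _ ≤ 8 * ((Real.log ξ ^ p / 2) / ξ ^ 2) := by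
        have hξ0 : 0 < ξ := by linarith
        have hpow' := hpow p
        gcongr
        linarith
    _ ≤ _ := by gcongr

theorem tendsto_inv_mul_log_pow (p : ℕ) :
    Tendsto (fun y : ℝ => y⁻¹ * Real.log y ^ p) atTop (𝓝 0) := by
  refine (Real.isLittleO_pow_log_id_atTop (n := p)).tendsto_div_nhds_zero.congr fun y => ?_
  rw [id, div_eq_inv_mul]

/-- `F N = W (log N) + O(N⁻¹ log ^ p N)` for some `p`. -/
def HasLogExpansion (F : ℕ → ℝ) (W : ℝ[X]) : Prop :=
  IsSoftBigO atTop (fun N : ℕ => Real.log N) (fun N => F N - W.eval (Real.log N))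
    fun N => (N : ℝ)⁻¹

theorem tendsto_log_natCast_atTop : Tendsto (fun N : ℕ => Real.log N) atTop atTop :=
  Real.tendsto_log_atTop.comp tendsto_natCast_atTop_atTop

theorem eventually_one_le_abs_log_natCast : ∀ᶠ N : ℕ in atTop, 1 ≤ |Real.log N| :=
  (tendsto_log_natCast_atTop.eventually_ge_atTop 1).mono fun _ h => h.trans (le_abs_self _)

theorem exists_sum_range_sub_isSoftBigO {a : ℕ → ℝ}
    (ha : IsSoftBigO atTop (fun N : ℕ => Real.log N) a fun N => (N : ℝ)⁻¹ ^ 2) :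
    ∃ c, IsSoftBigO atTop (fun N : ℕ => Real.log N) (fun N => ∑ n ∈ Finset.range N, a n - c)
      fun N => (N : ℝ)⁻¹ := by
  obtain ⟨p, hp⟩ := ha
  obtain ⟨K, hK, hb⟩ := hp.exists_pos
  set b : ℕ → ℝ := fun N => (N : ℝ)⁻¹ * Real.log N ^ p
  have majorant : ∀ᶠ N in atTop, |a N| ≤ K * 8 * b N - K * 8 * b (N + 1) := by
    filter_upwards [hb.bound, eventually_log_pow_div_sq_le p] with N h₁ h₂
    have h0 : 0 ≤ Real.log N := Real.log_natCast_nonneg N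
    rw [Real.norm_of_nonneg (by positivity : 0 ≤ (N : ℝ)⁻¹ ^ 2 * Real.log N ^ p)] at h₁
    calc |a N| ≤ K * ((N : ℝ)⁻¹ ^ 2 * Real.log N ^ p) := h₁
      _ ≤ K * (8 * (b N - b (N + 1))) := by gcongr
      _ = _ := by ring
  have hb₀ : Tendsto (fun N => K * 8 * b N) atTop (𝓝 0) := by
    simpa only [mul_zero, Function.comp_def] using
      ((tendsto_inv_mul_log_pow p).comp tendsto_natCast_atTop_atTop).const_mul (K * 8)
  obtain ⟨c, hc⟩ := exists_sum_range_sub_isBigO majorant hb₀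
  exact ⟨c, p, hc.trans ((isBigO_refl b atTop).const_mul_left (K * 8))⟩

theorem exists_hasLogExpansion_sum {a : ℕ → ℝ} (R : ℝ[X])
    (ha : IsSoftBigO atTop (fun N : ℕ => Real.log N)
      (fun N => a N - (R.eval (Real.log (N + 1 : ℕ)) - R.eval (Real.log N)))
      fun N => (N : ℝ)⁻¹ ^ 2) :
    ∃ V, HasLogExpansion (fun N => ∑ n ∈ Finset.Ioo 0 N, a n) V := by
  obtain ⟨c, hc⟩ := exists_sum_range_sub_isSoftBigO ha
  refine ⟨R + C (c - R.eval 0 - a 0), hc.congr_left ?_⟩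
  filter_upwards [eventually_gt_atTop 0] with N hN
  have hsplit : ∑ n ∈ Finset.range N, a n = a 0 + ∑ n ∈ Finset.Ioo 0 N, a n := by
    rw [Finset.range_eq_Ico, ← Finset.sum_Ioo_add_eq_sum_Ico hN, add_comm]
  rw [Finset.sum_sub_distrib, Finset.sum_range_sub fun n : ℕ => R.eval (Real.log n), hsplit,
    eval_add, eval_C, Nat.cast_zero, Real.log_zero]
  ring

theorem abs_log_add_one_sub_log_le {u : ℝ} (hu : 0 < u) :
    |Real.log (u + 1) - Real.log u - u⁻¹| ≤ u⁻¹ ^ 2 := by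
  rw [← Real.log_div (by positivity) hu.ne']
  have hupper := Real.log_le_sub_one_of_pos (show 0 < (u + 1) / u by positivity)
  have hlower := Real.one_sub_inv_le_log_of_pos (show 0 < (u + 1) / u by positivity)
  have eupper : (u + 1) / u - 1 = u⁻¹ := by field_simp; ring
  have elower : 1 - ((u + 1) / u)⁻¹ = u⁻¹ - u⁻¹ * (u + 1)⁻¹ := by field_simp; ring
  have hinv : u⁻¹ * (u + 1)⁻¹ ≤ u⁻¹ ^ 2 := by
    rw [sq]
    gcongr
    linarith
  rw [abs_le]
  constructor <;> nlinarith [sq_nonneg u⁻¹]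

theorem inv_isBigO_one_natCast : (fun N : ℕ => (N : ℝ)⁻¹) =O[atTop] fun _ => (1 : ℝ) :=
  tendsto_inv_atTop_nhds_zero_nat.isBigO_one ℝ

theorem inv_sq_isBigO_inv_natCast :
    (fun N : ℕ => (N : ℝ)⁻¹ ^ 2) =O[atTop] fun N : ℕ => (N : ℝ)⁻¹ := by
  simpa only [sq, mul_one] using
    (isBigO_refl (fun N : ℕ => (N : ℝ)⁻¹) atTop).mul inv_isBigO_one_natCast

theorem log_succ_sub_log_sub_inv_isBigO :
    (fun N : ℕ => Real.log (N + 1 : ℕ) - Real.log N - (N : ℝ)⁻¹) =O[atTop]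
      fun N : ℕ => (N : ℝ)⁻¹ ^ 2 := by
  refine IsBigO.of_bound' ?_
  filter_upwards [eventually_gt_atTop 0] with N hN
  rw [Nat.cast_succ, Real.norm_of_nonneg (sq_nonneg (N : ℝ)⁻¹)]
  exact abs_log_add_one_sub_log_le (Nat.cast_pos.2 hN)

theorem log_succ_sub_log_isBigO :
    (fun N : ℕ => Real.log (N + 1 : ℕ) - Real.log N) =O[atTop] fun N : ℕ => (N : ℝ)⁻¹ := by
  simpa only [sub_add_cancel] using
    (log_succ_sub_log_sub_inv_isBigO.trans inv_sq_isBigO_inv_natCast).add (isBigO_refl _ atTop)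

theorem log_succ_isBigO :
    (fun N : ℕ => Real.log (N + 1 : ℕ)) =O[atTop] fun N : ℕ => Real.log N := by
  have one_isBigO : (fun _ => (1 : ℝ)) =O[atTop] fun N : ℕ => Real.log N :=
    (isLittleO_const_left.2 <| .inr <|
      tendsto_norm_atTop_atTop.comp tendsto_log_natCast_atTop).isBigO
  simpa only [sub_add_cancel] using
    ((log_succ_sub_log_isBigO.trans inv_isBigO_one_natCast).trans one_isBigO).add
      (isBigO_refl (fun N : ℕ => Real.log N) atTop)

theorem inv_add_isBigO_inv (x : ℝ) :
    (fun N : ℕ => ((N : ℝ) + x)⁻¹) =O[atTop] fun N : ℕ => (N : ℝ)⁻¹ := by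
  refine IsBigO.inv_rev (IsBigO.of_bound 2 ?_) ?_
  · filter_upwards [tendsto_natCast_atTop_atTop.eventually_ge_atTop (2 * |x|)] with N hN
    rw [Real.norm_natCast, Real.norm_eq_abs]
    linarith [le_abs_self ((N : ℝ) + x), neg_abs_le x]
  · filter_upwards [eventually_gt_atTop 0] with N hN h
    exact absurd h (Nat.cast_ne_zero.2 hN.ne')

theorem inv_add_sub_inv_isBigO (x : ℝ) :
    (fun N : ℕ => ((N : ℝ) + x)⁻¹ - (N : ℝ)⁻¹) =O[atTop] fun N : ℕ => (N : ℝ)⁻¹ ^ 2 := by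
  have h : (fun N : ℕ => -x * (((N : ℝ) + x)⁻¹ * (N : ℝ)⁻¹)) =O[atTop]
      fun N : ℕ => (N : ℝ)⁻¹ ^ 2 := by
    simpa only [sq] using ((inv_add_isBigO_inv x).mul (isBigO_refl _ atTop)).const_mul_left (-x)
  refine h.congr' ?_ EventuallyEq.rfl
  filter_upwards [eventually_gt_atTop 0, tendsto_natCast_atTop_atTop.eventually_gt_atTop (-x)]
    with N hN hNx
  have hN' : (N : ℝ) ≠ 0 := Nat.cast_ne_zero.2 hN.ne'
  have hNx' : (N : ℝ) + x ≠ 0 := by linarith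
  field_simp
  ring

theorem HasLogExpansion.isSoftBigO_one {F : ℕ → ℝ} {W : ℝ[X]} (h : HasLogExpansion F W) :
    IsSoftBigO atTop (fun N : ℕ => Real.log N) F fun _ => 1 := by
  simpa only [sub_add_cancel] using (h.trans (.of_isBigO inv_isBigO_one_natCast)).add
    (isSoftBigO_eval W (isBigO_refl _ atTop) eventually_one_le_abs_log_natCast)
    eventually_one_le_abs_log_natCast

theorem HasLogExpansion.exists_sum_div_pow {F : ℕ → ℝ} {W : ℝ[X]} (h : HasLogExpansion F W)
    (x : ℝ) {κ : ℕ} (hκ : 2 ≤ κ) :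
    ∃ V, HasLogExpansion (fun N => ∑ n ∈ Finset.Ioo 0 N, F n / ((n : ℝ) + x) ^ κ) V := by
  have hpow : (fun N : ℕ => (((N : ℝ) + x)⁻¹) ^ κ) =O[atTop] fun N : ℕ => (N : ℝ)⁻¹ ^ 2 := by
    obtain ⟨j, rfl⟩ := Nat.exists_eq_add_of_le hκ
    simpa only [pow_add, one_pow, mul_one] using ((inv_add_isBigO_inv x).pow 2).mul
      (((inv_add_isBigO_inv x).trans inv_isBigO_one_natCast).pow j)
  refine exists_hasLogExpansion_sum 0 ?_
  simpa only [eval_zero, sub_zero, one_mul, inv_pow _ κ, ← div_eq_mul_inv (F _)] using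
    h.isSoftBigO_one.mul (.of_isBigO hpow)

theorem HasLogExpansion.exists_sum_div {F : ℕ → ℝ} {W : ℝ[X]} (h : HasLogExpansion F W) (x : ℝ) :
    ∃ V, HasLogExpansion (fun N => ∑ n ∈ Finset.Ioo 0 N, F n / ((n : ℝ) + x)) V := by
  obtain ⟨R, rfl⟩ := exists_derivative_eq W
  choose ξ hξ hR using fun N : ℕ => exists_eval_sub_eval_eq R (Real.log (N + 1 : ℕ)) (Real.log N)
  set W := R.derivative
  set d : ℕ → ℝ := fun N => Real.log (N + 1 : ℕ) - Real.log N
  have hL := eventually_one_le_abs_log_natCast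
  have hrefl := isBigO_refl (fun N : ℕ => Real.log N) atTop
  have hξd : (fun N : ℕ => Real.log N - ξ N) =O[atTop] d :=
    IsBigO.of_bound' (.of_forall fun N => (norm_sub_rev _ _).trans_le (hξ N))
  have hξL : ξ =O[atTop] fun N : ℕ => Real.log N := by
    simpa only [sub_sub_cancel] using hrefl.sub (hξd.trans (log_succ_isBigO.sub hrefl))
  have hF : IsSoftBigO atTop (fun N : ℕ => Real.log N)
      (fun N : ℕ => (F N - W.eval (Real.log N)) * ((N : ℝ) + x)⁻¹) fun N => (N : ℝ)⁻¹ ^ 2 := by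
    simpa only [sq] using IsSoftBigO.mul h (.of_isBigO (inv_add_isBigO_inv x))
  have hd : IsSoftBigO atTop (fun N : ℕ => Real.log N)
      (fun N : ℕ => W.eval (Real.log N) * (((N : ℝ) + x)⁻¹ - d N)) fun N => (N : ℝ)⁻¹ ^ 2 := by
    have hdiff := (inv_add_sub_inv_isBigO x).sub log_succ_sub_log_sub_inv_isBigO
    simpa only [sub_sub_sub_cancel_right, one_mul] using
      (isSoftBigO_eval W hrefl hL).mul (.of_isBigO hdiff)
  have hW : IsSoftBigO atTop (fun N : ℕ => Real.log N)
      (fun N => (W.eval (Real.log N) - W.eval (ξ N)) * d N) fun N => (N : ℝ)⁻¹ ^ 2 := by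
    simpa only [sq] using ((isSoftBigO_eval_sub_eval W hrefl hξL hL).trans
      (.of_isBigO (hξd.trans log_succ_sub_log_isBigO))).mul (.of_isBigO log_succ_sub_log_isBigO)
  refine exists_hasLogExpansion_sum R
    (((hF.add hd hL).add hW hL).congr_left (.of_forall fun N => ?_))
  dsimp only
  rw [hR]
  ring

end Summation

section ZetaTrunc

theorem prod_natCast_add_pow_pos {x : ℝ} (hx : -1 < x) {r : ℕ} (k : Fin r → ℕ+) {m : Fin r → ℕ}
    (hm : ∀ i, 0 < m i) : 0 < ∏ i, ((m i : ℝ) + x) ^ (k i : ℕ) := by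
  refine Finset.prod_pos fun i _ => pow_pos ?_ _
  have h : (1 : ℝ) ≤ m i := by exact_mod_cast hm i
  linarith

theorem zetaTrunc_nonneg {x : ℝ} (hx : -1 < x) {r : ℕ} (k : Fin r → ℕ+) (N : ℕ) :
    0 ≤ zetaTrunc x k N := by
  refine Finset.sum_nonneg fun m hm => one_div_nonneg.2 (prod_natCast_add_pow_pos hx k ?_).le
  simp only [Finset.mem_filter, Fintype.mem_piFinset, Finset.mem_Ioo] at hm
  exact fun i => (hm.1 i).1

theorem zetaTrunc_zero (x : ℝ) (k : Fin 0 → ℕ+) (N : ℕ) : zetaTrunc x k N = 1 := by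
  classical
  rw [zetaTrunc, Finset.filter_true_of_mem fun m _ => Subsingleton.strictMono m]
  simp

theorem strictMono_iff_init_and_lt_last {α : Type*} [Preorder α] {r : ℕ} {m : Fin (r + 1) → α} :
    StrictMono m ↔ StrictMono (Fin.init m) ∧ ∀ i : Fin r, m i.castSucc < m (Fin.last r) := by
  refine ⟨fun h => ⟨h.comp (Fin.strictMono_castSucc), fun i => h (Fin.castSucc_lt_last i)⟩,
    fun ⟨hinit, hlast⟩ i j hij => ?_⟩
  induction j using Fin.lastCases with
  | last =>
    obtain ⟨i, rfl⟩ := Fin.exists_castSucc_eq.2 hij.ne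
    exact hlast i
  | cast j =>
    obtain ⟨i, rfl⟩ := Fin.exists_castSucc_eq.2 (hij.trans (Fin.castSucc_lt_last j)).ne
    exact hinit (Fin.castSucc_lt_castSucc_iff.1 hij)

theorem zetaTrunc_succ (x : ℝ) {r : ℕ} (k : Fin (r + 1) → ℕ+) (N : ℕ) :
    zetaTrunc x k N = ∑ M ∈ Finset.Ioo 0 N,
      zetaTrunc x (fun i : Fin r => k i.castSucc) M / ((M : ℝ) + x) ^ (k (Fin.last r) : ℕ) := by
  classical
  simp only [zetaTrunc, Finset.sum_div]
  rw [Finset.sum_sigma']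
  refine Finset.sum_bij' (fun m _ => ⟨m (Fin.last r), Fin.init m⟩)
    (fun a _ => (Fin.snoc a.2 a.1 : Fin (r + 1) → ℕ)) ?_ ?_ (fun m _ => Fin.snoc_init_self m)
    (fun a _ => by simp) fun m _ => ?_
  · intro m hm
    simp only [Finset.mem_filter, Fintype.mem_piFinset, Finset.mem_Ioo,
      strictMono_iff_init_and_lt_last] at hm
    simp only [Finset.mem_sigma, Finset.mem_filter, Fintype.mem_piFinset, Finset.mem_Ioo]
    exact ⟨hm.1 _, fun i => ⟨(hm.1 i.castSucc).1, hm.2.2 i⟩, hm.2.1⟩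
  · rintro ⟨M, m⟩ h
    simp only [Finset.mem_sigma, Finset.mem_filter, Fintype.mem_piFinset, Finset.mem_Ioo] at h
    simp only [Finset.mem_filter, Fintype.mem_piFinset, Finset.mem_Ioo, Fin.forall_fin_succ',
      Fin.snoc_castSucc, Fin.snoc_last, strictMono_iff_init_and_lt_last, Fin.init_snoc]
    exact ⟨⟨fun i => ⟨(h.2.1 i).1, (h.2.1 i).2.trans h.1.2⟩, h.1⟩, h.2.2, fun i => (h.2.1 i).2⟩
  · rw [Fin.prod_univ_castSucc, div_div]
    rfl

theorem hasLogExpansion_zetaTrunc_zero (x : ℝ) (k : Fin 0 → ℕ+) :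
    HasLogExpansion (zetaTrunc x k) 1 :=
  .of_isBigO (by simpa only [zetaTrunc_zero, eval_one, sub_self] using isBigO_zero _ _)

theorem exists_hasLogExpansion_zetaTrunc (x : ℝ) {r : ℕ} (k : Fin r → ℕ+) :
    ∃ W, HasLogExpansion (zetaTrunc x k) W := by
  induction r with
  | zero => exact ⟨1, hasLogExpansion_zetaTrunc_zero x k⟩
  | succ r ih =>
    obtain ⟨W, hW⟩ := ih fun i => k i.castSucc
    simp only [funext (zetaTrunc_succ x k)]
    rcases (one_le (a := k (Fin.last r))).eq_or_lt with hk | hk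
    · simpa only [← hk, PNat.one_coe, pow_one] using hW.exists_sum_div x
    · exact hW.exists_sum_div_pow x (by exact_mod_cast hk)

end ZetaTrunc

section ExponentialLaw

theorem expMeasure_one : expMeasure 1 =
    (volume.restrict (Ioi 0)).withDensity fun v => ENNReal.ofReal (Real.exp (-v)) := by
  have hdensity : gammaPDF 1 1 =
      (Ici (0 : ℝ)).indicator fun v => ENNReal.ofReal (Real.exp (-v)) := by
    ext v
    by_cases hv : 0 ≤ v <;> simp [gammaPDF, gammaPDFReal, indicator, hv]
  rw [expMeasure, gammaMeasure, hdensity, withDensity_indicator measurableSet_Ici,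
    Measure.restrict_congr_set Ioi_ae_eq_Ici]

theorem integral_expMeasure_one (f : ℝ → ℝ) :
    ∫ v, f v ∂expMeasure 1 = ∫ v in Ioi 0, Real.exp (-v) * f v := by
  rw [expMeasure_one, integral_withDensity_eq_integral_toReal_smul (by fun_prop) (by simp)]
  simp [ENNReal.toReal_ofReal (Real.exp_pos _).le]

theorem integrable_expMeasure_one_iff (f : ℝ → ℝ) :
    Integrable f (expMeasure 1) ↔ IntegrableOn (fun v => Real.exp (-v) * f v) (Ioi 0) := by
  rw [expMeasure_one, integrable_withDensity_iff_integrable_smul' (by fun_prop) (by simp),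
    IntegrableOn]
  simp [ENNReal.toReal_ofReal (Real.exp_pos _).le]

theorem ae_pos_expMeasure_one : ∀ᵐ v ∂expMeasure 1, 0 < v := by
  rw [expMeasure_one]
  exact (withDensity_absolutelyContinuous _ _).ae_le (ae_restrict_mem measurableSet_Ioi)

theorem expMeasure_one_Ici {a : ℝ} (ha : 0 ≤ a) :
    expMeasure 1 (Ici a) = ENNReal.ofReal (Real.exp (-a)) := by
  rw [expMeasure_one, Measure.restrict_congr_set Ioi_ae_eq_Ici,
    withDensity_apply _ measurableSet_Ici,
    Measure.restrict_restrict measurableSet_Ici, inter_eq_left.2 (Ici_subset_Ici.2 ha),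
    Measure.restrict_congr_set Ioi_ae_eq_Ici.symm, ← ofReal_integral_eq_lintegral_ofReal
      (integrableOn_exp_neg_Ioi a) (ae_of_all _ fun v => (Real.exp_pos _).le),
    integral_exp_neg_Ioi]

theorem integrable_rpow_expMeasure_one {y : ℝ} (hy : -1 < y) :
    Integrable (fun v : ℝ => v ^ y) (expMeasure 1) := by
  rw [integrable_expMeasure_one_iff]
  simpa using Real.GammaIntegral_convergent (s := y + 1) (by linarith)

theorem integral_rpow_expMeasure_one {y : ℝ} (hy : -1 < y) :
    ∫ v : ℝ, v ^ y ∂expMeasure 1 = Real.Gamma (1 + y) := by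
  rw [integral_expMeasure_one, Real.Gamma_eq_integral (by linarith)]
  simp

end ExponentialLaw

section Rho

/-- The random variable `γ + log v`; for `v` exponentially distributed its moment generating
function is `e^{γ y} Γ(1 + y)`, the function whose Taylor series is `gammaSeries`. -/
noncomputable def shiftedLog (v : ℝ) : ℝ := Real.eulerMascheroniConstant + Real.log v

theorem exp_mul_shiftedLog_ae_eq (y : ℝ) :
    (fun v => Real.exp (y * shiftedLog v)) =ᵐ[expMeasure 1]
      fun v => Real.exp (Real.eulerMascheroniConstant * y) * v ^ y := by
  filter_upwards [ae_pos_expMeasure_one] with v hv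
  rw [shiftedLog, Real.rpow_def_of_pos hv, ← Real.exp_add]
  ring_nf

theorem mgf_shiftedLog {y : ℝ} (hy : -1 < y) : mgf shiftedLog (expMeasure 1) y =
    Real.exp (Real.eulerMascheroniConstant * y) * Real.Gamma (1 + y) := by
  rw [mgf, integral_congr_ae (exp_mul_shiftedLog_ae_eq y), integral_const_mul,
    integral_rpow_expMeasure_one hy]

theorem zero_mem_interior_integrableExpSet_shiftedLog :
    (0 : ℝ) ∈ interior (integrableExpSet shiftedLog (expMeasure 1)) := by
  rw [mem_interior_iff_mem_nhds]
  filter_upwards [Ioi_mem_nhds (show (-1 : ℝ) < 0 by norm_num)] with y hy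
  exact ((integrable_rpow_expMeasure_one hy).const_mul _).congr (exp_mul_shiftedLog_ae_eq y).symm

theorem integrable_shiftedLog_pow (n : ℕ) :
    Integrable (fun v => shiftedLog v ^ n) (expMeasure 1) :=
  integrable_pow_of_mem_interior_integrableExpSet zero_mem_interior_integrableExpSet_shiftedLog n

theorem coeff_gammaSeries (n : ℕ) :
    PowerSeries.coeff n gammaSeries = (∫ v, shiftedLog v ^ n ∂expMeasure 1) / n.factorial := by
  have h : (fun y : ℝ => Real.exp (Real.eulerMascheroniConstant * y) * Real.Gamma (1 + y))
      =ᶠ[𝓝 0] mgf shiftedLog (expMeasure 1) := by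
    filter_upwards [Ioi_mem_nhds (show (-1 : ℝ) < 0 by norm_num)] with y hy
    exact (mgf_shiftedLog hy).symm
  rw [gammaSeries, PowerSeries.coeff_mk, h.iteratedDeriv_eq,
    iteratedDeriv_mgf_zero zero_mem_interior_integrableExpSet_shiftedLog]
  rfl

theorem integrable_eval_add_shiftedLog (W : ℝ[X]) (a : ℝ) :
    Integrable (fun v => W.eval (a + shiftedLog v)) (expMeasure 1) := by
  have h : ∀ v, W.eval (a + shiftedLog v) = ∑ i ∈ Finset.range ((taylor a W).natDegree + 1),
      (taylor a W).coeff i * shiftedLog v ^ i := fun v => by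
    rw [← eval_eq_sum_range, taylor_eval, add_comm]
  simp only [h]
  exact integrable_finsetSum _ fun i _ => (integrable_shiftedLog_pow i).const_mul _

theorem rho_monomial_one (n : ℕ) : rho (monomial n 1) =
    (n.factorial : ℝ) • PowerSeries.coeff n (PowerSeries.map C gammaSeries * expTy) := by
  rw [rho, ← congrFun (coe_basisMonomials ℝ) n, Module.Basis.constr_basis]

theorem eval_rho_monomial_one (n : ℕ) (a : ℝ) :
    (rho (monomial n 1)).eval a = ∫ v, (a + shiftedLog v) ^ n ∂expMeasure 1 := by
  simp only [rho_monomial_one, PowerSeries.coeff_mul, eval_smul, eval_finsetSum,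
    PowerSeries.coeff_map, eval_mul, eval_C, expTy, PowerSeries.coeff_mk, eval_monomial,
    coeff_gammaSeries, smul_eq_mul, add_comm a, fun b : ℝ => (Commute.all b a).add_pow' n,
    nsmul_eq_mul]
  rw [integral_finsetSum _ fun ij _ => ((integrable_shiftedLog_pow _).mul_const _).const_mul _,
    Finset.mul_sum]
  refine Finset.sum_congr rfl fun ⟨i, j⟩ hij => ?_
  obtain rfl := Finset.HasAntidiagonal.mem_antidiagonal.1 hij
  have hchoose : (((i + j).choose i : ℕ) : ℝ) * i.factorial * j.factorial = (i + j).factorial := by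
    rw [Nat.choose_symm_add]
    exact_mod_cast Nat.add_choose_mul_factorial_mul_factorial i j
  rw [integral_const_mul, integral_mul_const, ← hchoose]
  field_simp

theorem eval_rho (W : ℝ[X]) (a : ℝ) :
    (rho W).eval a = ∫ v, W.eval (a + shiftedLog v) ∂expMeasure 1 := by
  induction W using Polynomial.induction_on' with
  | add P Q hP hQ =>
    simp only [map_add, eval_add, hP, hQ]
    rw [integral_add (integrable_eval_add_shiftedLog P a) (integrable_eval_add_shiftedLog Q a)]
  | monomial n c =>
    rw [← mul_one c, ← smul_eq_mul, ← smul_monomial, map_smul]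
    simp only [eval_smul, eval_rho_monomial_one, eval_monomial, one_mul, smul_eq_mul,
      integral_const_mul]

theorem rho_one : rho 1 = 1 := by
  have := isProbabilityMeasure_expMeasure one_pos
  refine Polynomial.funext fun a => ?_
  simp [eval_rho]

end Rho

section Abel

theorem tsum_mul_exp_neg_eq_lintegral {ι : Type*} [Countable ι] (c : ι → ENNReal) {a : ι → ℝ}
    (ha : ∀ i, 0 ≤ a i) : ∑' i, c i * ENNReal.ofReal (Real.exp (-a i)) =
      ∫⁻ v, ∑' i, (Ici (a i)).indicator (fun _ => c i) v ∂expMeasure 1 := by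
  rw [lintegral_tsum fun i => (measurable_const.indicator measurableSet_Ici).aemeasurable]
  exact tsum_congr fun i => by
    rw [lintegral_indicator_const measurableSet_Ici, expMeasure_one_Ici (ha i)]

theorem tsum_ite_last_le_eq_zetaTrunc {x : ℝ} (hx : -1 < x) {r : ℕ} (k : Fin (r + 1) → ℕ+)
    (n : ℕ) :
    ∑' m : {m : Fin (r + 1) → ℕ // StrictMono m ∧ ∀ i, 0 < m i},
      (if m.1 (Fin.last r) ≤ n then
        ENNReal.ofReal (1 / ∏ i, ((m.1 i : ℝ) + x) ^ (k i : ℕ)) else 0)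
      = ENNReal.ofReal (zetaTrunc x k (n + 1)) := by
  classical
  set S : Set (Fin (r + 1) → ℕ) := {m | StrictMono m ∧ ∀ i, 0 < m i}
  set w : (Fin (r + 1) → ℕ) → ENNReal := fun m =>
    ENNReal.ofReal (1 / ∏ i, ((m i : ℝ) + x) ^ (k i : ℕ))
  set A := (Fintype.piFinset fun _ : Fin (r + 1) => Finset.Ioo 0 (n + 1)).filter StrictMono
  have mem_A : ∀ m, m ∈ A ↔ m ∈ S ∧ m (Fin.last r) ≤ n := fun m => by
    simp only [A, S, Finset.mem_filter, Fintype.mem_piFinset, Finset.mem_Ioo, Nat.lt_succ_iff,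
      mem_ofPred_eq]
    exact ⟨fun h => ⟨⟨h.2, fun i => (h.1 i).1⟩, (h.1 _).2⟩, fun h =>
      ⟨fun i => ⟨h.1.2 i, (h.1.1.monotone (Fin.le_last i)).trans h.2⟩, h.1.1⟩⟩
  calc ∑' m : S, (if m.1 (Fin.last r) ≤ n then w m else 0)
      = ∑' m, S.indicator (fun m => if m (Fin.last r) ≤ n then w m else 0) m :=
        tsum_subtype S fun m => if m (Fin.last r) ≤ n then w m else 0
    _ = ∑' m, (A : Set (Fin (r + 1) → ℕ)).indicator w m := tsum_congr fun m => by
        simp only [indicator, Finset.mem_coe, mem_A, ite_and]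
    _ = ∑ m ∈ A, w m := (sum_eq_tsum_indicator w A).symm
    _ = ENNReal.ofReal (zetaTrunc x k (n + 1)) :=
        (ENNReal.ofReal_sum_of_nonneg fun m hm => one_div_nonneg.2
          (prod_natCast_add_pow_pos hx k ((mem_A m).1 hm).1.2).le).symm

theorem measurable_comp_floor_div (F : ℕ → ℝ) (s : ℝ) :
    Measurable fun v : ℝ => F (⌊v / s⌋₊ + 1) :=
  (measurable_from_nat (f := fun n => F (n + 1))).comp
    (Nat.measurable_floor.comp (measurable_id.div_const s))

theorem hurwitzLi_exp_neg {x : ℝ} (hx : -1 < x) {r : ℕ} (k : Fin (r + 1) → ℕ+) {s : ℝ}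
    (hs : 0 < s) : hurwitzLi x k (Real.exp (-s)) =
      Real.exp (-s) ^ x * ∫ v, zetaTrunc x k (⌊v / s⌋₊ + 1) ∂expMeasure 1 := by
  set w : {m : Fin (r + 1) → ℕ // StrictMono m ∧ ∀ i, 0 < m i} → ℝ := fun m =>
    1 / ∏ i, ((m.1 i : ℝ) + x) ^ (k i : ℕ)
  have hw : ∀ m, 0 ≤ w m := fun m => one_div_nonneg.2 (prod_natCast_add_pow_pos hx k m.2.2).le
  have hterm : ∀ m : {m : Fin (r + 1) → ℕ // StrictMono m ∧ ∀ i, 0 < m i},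
      Real.exp (-s) ^ ((m.1 (Fin.last r) : ℝ) + x) / ∏ i, ((m.1 i : ℝ) + x) ^ (k i : ℕ) =
        Real.exp (-s) ^ x * (w m * Real.exp (-(m.1 (Fin.last r) * s))) := fun m => by
    rw [Real.rpow_add (Real.exp_pos _), ← Real.exp_mul, neg_mul, mul_comm s, div_eq_mul_one_div]
    ring
  simp only [hurwitzLi, hterm]
  rw [tsum_mul_left]
  congr 1
  calc ∑' m, w m * Real.exp (-(m.1 (Fin.last r) * s))
      = (∑' m, ENNReal.ofReal (w m) *
          ENNReal.ofReal (Real.exp (-(m.1 (Fin.last r) * s)))).toReal := by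
        rw [ENNReal.tsum_toReal_eq fun m => ENNReal.mul_ne_top ENNReal.ofReal_ne_top
          ENNReal.ofReal_ne_top]
        simp only [ENNReal.toReal_mul, ENNReal.toReal_ofReal (hw _),
          ENNReal.toReal_ofReal (Real.exp_nonneg _)]
    _ = (∫⁻ v, ENNReal.ofReal (zetaTrunc x k (⌊v / s⌋₊ + 1)) ∂expMeasure 1).toReal := by
        have le_floor_iff : ∀ (m : {m : Fin (r + 1) → ℕ // StrictMono m ∧ ∀ i, 0 < m i}) (v : ℝ),
            m.1 (Fin.last r) ≤ ⌊v / s⌋₊ ↔ m.1 (Fin.last r) * s ≤ v := fun m v => by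
          rw [Nat.le_floor_iff' (m.2.2 _).ne', le_div_iff₀ hs]
        rw [tsum_mul_exp_neg_eq_lintegral _ fun m => by positivity]
        simp only [← tsum_ite_last_le_eq_zetaTrunc hx k, le_floor_iff, indicator, mem_Ici]
        rfl
    _ = ∫ v, zetaTrunc x k (⌊v / s⌋₊ + 1) ∂expMeasure 1 :=
        (integral_eq_lintegral_of_nonneg_ae (ae_of_all _ fun v => zetaTrunc_nonneg hx k _)
          (measurable_comp_floor_div _ _).aestronglyMeasurable).symm

end Abel

section Laplace

theorem inv_floor_add_one_le {u : ℝ} (hu : 0 < u) :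
    ((⌊u⌋₊ + 1 : ℕ) : ℝ)⁻¹ ≤ min 1 u⁻¹ := by
  refine le_min (Nat.cast_inv_le_one _) (inv_anti₀ hu ?_)
  exact_mod_cast (Nat.lt_floor_add_one u).le

theorem log_floor_add_one_le (u : ℝ) : Real.log (⌊u⌋₊ + 1 : ℕ) ≤ 1 + |Real.log u| := by
  have hlog2 : Real.log 2 ≤ 1 := by linarith [Real.log_two_lt_d9]
  rcases lt_or_ge u 1 with hu | hu
  · rw [Nat.floor_eq_zero.2 hu, zero_add, Nat.cast_one, Real.log_one]
    positivity
  · have hu₀ : 0 < u := by linarith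
    have hfloor : ((⌊u⌋₊ + 1 : ℕ) : ℝ) ≤ 2 * u := by
      push_cast
      linarith [Nat.floor_le hu₀.le]
    calc Real.log (⌊u⌋₊ + 1 : ℕ) ≤ Real.log (2 * u) := Real.log_le_log (by positivity) hfloor
      _ = Real.log 2 + Real.log u := Real.log_mul two_ne_zero hu₀.ne'
      _ ≤ 1 + |Real.log u| := add_le_add hlog2 (le_abs_self _)

theorem abs_log_floor_add_one_sub_log_le {u : ℝ} (hu : 0 < u) :
    |Real.log (⌊u⌋₊ + 1 : ℕ) - Real.log u| ≤ min 1 u⁻¹ * (1 + |Real.log u|) := by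
  rcases lt_or_ge u 1 with hu₁ | hu₁
  · rw [Nat.floor_eq_zero.2 hu₁, min_eq_left ((one_le_inv₀ hu).2 hu₁.le), zero_add, Nat.cast_one,
      Real.log_one, zero_sub, abs_neg, one_mul]
    exact le_add_of_nonneg_left zero_le_one
  · rw [min_eq_right (inv_le_one_of_one_le₀ hu₁)]
    have hlower : u ≤ (⌊u⌋₊ + 1 : ℕ) := by exact_mod_cast (Nat.lt_floor_add_one u).le
    have hupper : ((⌊u⌋₊ + 1 : ℕ) : ℝ) ≤ u + 1 := by
      push_cast
      linarith [Nat.floor_le hu.le]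
    rw [abs_of_nonneg (sub_nonneg.2 (Real.log_le_log hu hlower)),
      ← Real.log_div (by positivity) hu.ne']
    calc Real.log ((⌊u⌋₊ + 1 : ℕ) / u) ≤ (⌊u⌋₊ + 1 : ℕ) / u - 1 :=
          Real.log_le_sub_one_of_pos (by positivity)
      _ ≤ (u + 1) / u - 1 := by gcongr
      _ = u⁻¹ := by field_simp; ring
      _ ≤ u⁻¹ * (1 + |Real.log u|) :=
          le_mul_of_one_le_right (by positivity) (le_add_of_nonneg_right (abs_nonneg _))

theorem one_le_abs_one_add_abs (a : ℝ) : 1 ≤ |(1 + |a|)| :=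
  (le_add_of_nonneg_right (abs_nonneg a)).trans (le_abs_self _)

variable {F : ℕ → ℝ} {W : ℝ[X]}

theorem HasLogExpansion.exists_abs_sub_eval_le (h : HasLogExpansion F W) : ∃ (C : ℝ) (p : ℕ),
    ∀ N : ℕ, 0 < N → |F N - W.eval (Real.log N)| ≤ C * ((N : ℝ)⁻¹ * (1 + Real.log N) ^ p) := by
  have hgauge : (fun N : ℕ => Real.log N) =O[atTop] fun N : ℕ => 1 + Real.log N :=
    IsBigO.of_bound' (.of_forall fun N => by
      have := Real.log_natCast_nonneg N
      rw [Real.norm_of_nonneg this, Real.norm_of_nonneg (by positivity)]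
      exact le_add_of_nonneg_left zero_le_one)
  obtain ⟨p, hp⟩ := h.of_gauge_isBigO hgauge
  obtain ⟨C, -, hC⟩ := bound_of_isBigO_nat_atTop hp
  refine ⟨C, p, fun N hN => ?_⟩
  have hpos : 0 < (N : ℝ)⁻¹ * (1 + Real.log N) ^ p := by
    have := Real.log_natCast_nonneg N
    positivity
  simpa only [Real.norm_of_nonneg hpos.le, Real.norm_eq_abs] using hC hpos.ne'

theorem HasLogExpansion.isSoftBigO_floor (h : HasLogExpansion F W) :
    IsSoftBigO (𝓟 (Ioi 0)) (fun u => 1 + |Real.log u|)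
      (fun u => F (⌊u⌋₊ + 1) - W.eval (Real.log u)) fun u => min 1 u⁻¹ := by
  have hL : ∀ᶠ u in 𝓟 (Ioi (0 : ℝ)), 1 ≤ |(1 + |Real.log u|)| :=
    .of_forall fun u => one_le_abs_one_add_abs _
  have hfloor : IsSoftBigO (𝓟 (Ioi 0)) (fun u => 1 + |Real.log u|)
      (fun u => F (⌊u⌋₊ + 1) - W.eval (Real.log (⌊u⌋₊ + 1 : ℕ))) fun u => min 1 u⁻¹ := by
    obtain ⟨C, p, hC⟩ := h.exists_abs_sub_eval_le
    refine ⟨p, isBigO_principal.2 ⟨|C| * 2 ^ p, fun u hu => (hC _ (Nat.succ_pos _)).trans ?_⟩⟩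
    have hmin := lt_min one_pos (inv_pos.2 (mem_Ioi.1 hu))
    have hlog := log_floor_add_one_le u
    have := Real.log_natCast_nonneg (⌊u⌋₊ + 1)
    rw [Real.norm_of_nonneg (by positivity)]
    calc C * (((⌊u⌋₊ + 1 : ℕ) : ℝ)⁻¹ * (1 + Real.log (⌊u⌋₊ + 1 : ℕ)) ^ p)
        ≤ |C| * (min 1 u⁻¹ * (2 * (1 + |Real.log u|)) ^ p) := by
          gcongr
          · exact le_abs_self C
          · exact inv_floor_add_one_le hu
          · linarith [abs_nonneg (Real.log u)]
      _ = |C| * 2 ^ p * (min 1 u⁻¹ * (1 + |Real.log u|) ^ p) := by rw [mul_pow]; ring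
  have heval : IsSoftBigO (𝓟 (Ioi 0)) (fun u => 1 + |Real.log u|)
      (fun u => W.eval (Real.log (⌊u⌋₊ + 1 : ℕ)) - W.eval (Real.log u)) fun u => min 1 u⁻¹ := by
    refine (isSoftBigO_eval_sub_eval W ?_ ?_ hL).trans (.of_isBigO_mul ?_) <;>
      refine IsBigO.of_bound' (eventually_principal.2 fun u hu => ?_)
    · rw [Real.norm_of_nonneg (Real.log_natCast_nonneg _)]
      exact (log_floor_add_one_le u).trans (le_abs_self _)
    · exact (le_add_of_nonneg_left zero_le_one).trans (le_abs_self _)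
    · exact (abs_log_floor_add_one_sub_log_le hu).trans (le_abs_self _)
  simpa only [sub_add_sub_cancel] using hfloor.add heval hL

theorem one_add_abs_log_pow_le (p : ℕ) {δ u : ℝ} (hδ : 0 < δ) (hδ₁ : δ ≤ 1) (hu : 0 < u) :
    (1 + |Real.log u|) ^ p ≤ p.factorial * Real.exp 1 * δ⁻¹ ^ p * (u ^ δ + u ^ (-δ)) := by
  have hexp : Real.exp (δ * (1 + |Real.log u|)) ≤ Real.exp 1 * (u ^ δ + u ^ (-δ)) := by
    rw [mul_add, Real.exp_add, mul_one]
    gcongr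
    rw [Real.rpow_def_of_pos hu, Real.rpow_def_of_pos hu, mul_comm (Real.log u),
      mul_comm (Real.log u), neg_mul]
    rcases abs_choice (Real.log u) with h | h <;> rw [h]
    · exact le_add_of_nonneg_right (Real.exp_nonneg _)
    · rw [mul_neg]
      exact le_add_of_nonneg_left (Real.exp_nonneg _)
  have hpow := (div_le_iff₀ (by positivity)).1
    ((Real.pow_div_factorial_le_exp (δ * (1 + |Real.log u|)) (by positivity) p).trans hexp)
  calc (1 + |Real.log u|) ^ p = δ⁻¹ ^ p * (δ * (1 + |Real.log u|)) ^ p := by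
        rw [← mul_pow, inv_mul_cancel_left₀ hδ.ne']
    _ ≤ δ⁻¹ ^ p * (Real.exp 1 * (u ^ δ + u ^ (-δ)) * p.factorial) := by gcongr
    _ = _ := by ring

theorem min_one_inv_le_rpow {δ u : ℝ} (hδ : 0 ≤ δ) (hδ₁ : δ ≤ 1) (hu : 0 < u) :
    min 1 u⁻¹ ≤ u ^ (δ - 1) := by
  rcases le_total u 1 with h | h
  · exact (min_le_left _ _).trans
      (Real.one_le_rpow_of_pos_of_le_one_of_nonpos hu h (by linarith))
  · rw [← Real.rpow_neg_one]
    exact (min_le_right _ _).trans (Real.rpow_le_rpow_of_exponent_le h (by linarith))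

theorem min_mul_one_add_abs_log_pow_le (p : ℕ) {δ u : ℝ} (hδ : 0 < δ) (hδ₁ : δ ≤ 1 / 2)
    (hu : 0 < u) : min 1 u⁻¹ * (1 + |Real.log u|) ^ p ≤
      p.factorial * Real.exp 1 * δ⁻¹ ^ p * (u ^ (3 * δ - 1) + u ^ (δ - 1)) := by
  calc min 1 u⁻¹ * (1 + |Real.log u|) ^ p
      ≤ u ^ (2 * δ - 1) * (p.factorial * Real.exp 1 * δ⁻¹ ^ p * (u ^ δ + u ^ (-δ))) := by
        gcongr
        · exact min_one_inv_le_rpow (by linarith) (by linarith) hu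
        · exact one_add_abs_log_pow_le p hδ (by linarith) hu
    _ = p.factorial * Real.exp 1 * δ⁻¹ ^ p *
        (u ^ (2 * δ - 1) * u ^ δ + u ^ (2 * δ - 1) * u ^ (-δ)) := by ring
    _ = _ := by
      rw [← Real.rpow_add hu, ← Real.rpow_add hu]
      ring_nf

theorem div_rpow_ae_eq {s : ℝ} (hs : 0 < s) (y : ℝ) :
    (fun v : ℝ => (v / s) ^ (y - 1)) =ᵐ[expMeasure 1] fun v => s ^ (1 - y) * v ^ (y - 1) := by
  filter_upwards [ae_pos_expMeasure_one] with v hv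
  rw [Real.div_rpow hv.le hs.le, div_eq_inv_mul, ← Real.rpow_neg hs.le, neg_sub]

theorem integrable_div_rpow_expMeasure_one {s y : ℝ} (hs : 0 < s) (hy : 0 < y) :
    Integrable (fun v : ℝ => (v / s) ^ (y - 1)) (expMeasure 1) :=
  ((integrable_rpow_expMeasure_one (by linarith)).const_mul _).congr (div_rpow_ae_eq hs y).symm

theorem integral_div_rpow_expMeasure_one {s y : ℝ} (hs : 0 < s) (hy : 0 < y) :
    ∫ v : ℝ, (v / s) ^ (y - 1) ∂expMeasure 1 = s ^ (1 - y) * Real.Gamma y := by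
  rw [integral_congr_ae (div_rpow_ae_eq hs y), integral_const_mul,
    integral_rpow_expMeasure_one (by linarith), add_sub_cancel]

theorem eventually_le_neg_log (c : ℝ) : ∀ᶠ s in 𝓝[>] (0 : ℝ), c ≤ -Real.log s :=
  (tendsto_neg_atBot_atTop.comp Real.tendsto_log_nhdsGT_zero).eventually_ge_atTop c

theorem rpow_mul_Gamma_isBigO {c : ℝ} (hc : 0 < c) :
    (fun s => s ^ (1 - c / -Real.log s) * Real.Gamma (c / -Real.log s)) =O[𝓝[>] 0]
      fun s => s * Real.log s := by
  have hΓ : Tendsto (fun s => Real.Gamma (c / -Real.log s + 1)) (𝓝[>] 0) (𝓝 1) := by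
    have hy : Tendsto (fun s => c / -Real.log s + 1) (𝓝[>] 0) (𝓝 1) := by
      simpa only [zero_add, Function.comp_def] using (tendsto_const_nhds.div_atTop
        (tendsto_neg_atBot_atTop.comp Real.tendsto_log_nhdsGT_zero)).add_const 1
    simpa only [Real.Gamma_one, Function.comp_def] using
      Real.hasDerivAt_Gamma_one.continuousAt.tendsto.comp hy
  have heq : (fun s => s ^ (1 - c / -Real.log s) * Real.Gamma (c / -Real.log s)) =ᶠ[𝓝[>] 0]
      fun s => -(Real.exp c / c) * (Real.Gamma (c / -Real.log s + 1) * (s * Real.log s)) := by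
    filter_upwards [self_mem_nhdsWithin, eventually_le_neg_log 1] with s hs hlog
    have hlog₀ : Real.log s ≠ 0 := by linarith
    have hpow : s ^ (1 - c / -Real.log s) = s * Real.exp c := by
      rw [Real.rpow_sub hs, Real.rpow_one, Real.rpow_def_of_pos hs, div_eq_mul_inv, ← Real.exp_neg]
      congr 2
      field_simp
    rw [hpow, Real.Gamma_add_one (div_ne_zero hc.ne' (neg_ne_zero.2 hlog₀))]
    field_simp
  refine heq.trans_isBigO (IsBigO.const_mul_left ?_ _)
  simpa only [one_mul] using (hΓ.isBigO_one ℝ).mul (isBigO_refl (fun s => s * Real.log s) _)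

variable {e : ℝ → ℝ}

theorem IsSoftBigO.exists_abs_le_rpow
    (h : IsSoftBigO (𝓟 (Ioi 0)) (fun u => 1 + |Real.log u|) e fun u => min 1 u⁻¹) :
    ∃ (C : ℝ) (p : ℕ), ∀ δ u, 0 < δ → δ ≤ 1 / 2 → 0 < u →
      |e u| ≤ C * δ⁻¹ ^ p * (u ^ (3 * δ - 1) + u ^ (δ - 1)) := by
  obtain ⟨p, hp⟩ := h
  obtain ⟨C, hC⟩ := isBigO_principal.1 hp
  refine ⟨|C| * (p.factorial * Real.exp 1), p, fun δ u hδ hδ₁ hu => (hC u hu).trans ?_⟩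
  have := lt_min one_pos (inv_pos.2 hu)
  rw [Real.norm_of_nonneg (by positivity)]
  calc C * (min 1 u⁻¹ * (1 + |Real.log u|) ^ p)
      ≤ |C| * (p.factorial * Real.exp 1 * δ⁻¹ ^ p * (u ^ (3 * δ - 1) + u ^ (δ - 1))) :=
        mul_le_mul (le_abs_self C) (min_mul_one_add_abs_log_pow_le p hδ hδ₁ hu) (by positivity)
          (abs_nonneg C)
    _ = _ := by ring

theorem IsSoftBigO.integrable_comp_div
    (h : IsSoftBigO (𝓟 (Ioi 0)) (fun u => 1 + |Real.log u|) e fun u => min 1 u⁻¹)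
    (he : Measurable e) {s : ℝ} (hs : 0 < s) :
    Integrable (fun v => e (v / s)) (expMeasure 1) := by
  obtain ⟨C, p, hC⟩ := h.exists_abs_le_rpow
  refine (((integrable_div_rpow_expMeasure_one hs (y := 3 * (1 / 2)) (by norm_num)).add
    (integrable_div_rpow_expMeasure_one hs (y := 1 / 2) (by norm_num))).const_mul
      (C * (1 / 2 : ℝ)⁻¹ ^ p)).mono' (he.comp (measurable_id.div_const s)).aestronglyMeasurable ?_
  filter_upwards [ae_pos_expMeasure_one] with v hv
  exact hC _ _ (by norm_num) le_rfl (div_pos hv hs)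

/-- Bounding by `u ^ (3δ - 1) + u ^ (δ - 1)` with the scale-dependent exponent `δ = 1 / (-log s)`
makes `s ^ δ` constant, while the blow-up `Γ(δ) ~ 1 / δ` costs only one more logarithm. -/
theorem IsSoftBigO.integral_comp_div
    (h : IsSoftBigO (𝓟 (Ioi 0)) (fun u => 1 + |Real.log u|) e fun u => min 1 u⁻¹) :
    IsSoftBigO (𝓝[>] 0) Real.log (fun s => ∫ v, e (v / s) ∂expMeasure 1) fun s => s := by
  obtain ⟨C, p, hC⟩ := h.exists_abs_le_rpow
  set Φ : ℝ → ℝ → ℝ := fun c s => s ^ (1 - c / -Real.log s) * Real.Gamma (c / -Real.log s)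
  have hbound : (fun s => ∫ v, e (v / s) ∂expMeasure 1) =O[𝓝[>] 0]
      fun s => C * (-Real.log s) ^ p * (Φ 3 s + Φ 1 s) := by
    refine IsBigO.of_bound' ?_
    filter_upwards [self_mem_nhdsWithin, eventually_le_neg_log 2] with s hs hlog
    replace hs : 0 < s := hs
    have hlog₀ : 0 < -Real.log s := by linarith
    have hi : ∀ {c : ℝ}, 0 < c →
        Integrable (fun v : ℝ => (v / s) ^ (c / -Real.log s - 1)) (expMeasure 1) := fun hc =>
      integrable_div_rpow_expMeasure_one hs (div_pos hc hlog₀)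
    have hint : ∀ {c : ℝ}, 0 < c →
        ∫ v : ℝ, (v / s) ^ (c / -Real.log s - 1) ∂expMeasure 1 = Φ c s := fun hc =>
      integral_div_rpow_expMeasure_one hs (div_pos hc hlog₀)
    refine (norm_integral_le_of_norm_le (((hi three_pos).add (hi one_pos)).const_mul
      (C * (-Real.log s) ^ p)) ?_).trans ?_
    · filter_upwards [ae_pos_expMeasure_one] with v hv
      have := hC (1 / -Real.log s) (v / s) (by positivity)
        (one_div_le_one_div_of_le two_pos hlog) (div_pos hv hs)
      rwa [one_div, inv_inv, ← div_eq_mul_inv, ← one_div] at this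
    · simp only [Pi.add_apply]
      rw [integral_const_mul, integral_add (hi three_pos) (hi one_pos), hint three_pos,
        hint one_pos]
      exact le_abs_self _
  have hlog : (fun s => C * (-Real.log s) ^ p) =O[𝓝[>] 0] fun s => Real.log s ^ p :=
    (((isBigO_refl Real.log _).neg_left).pow p).const_mul_left C
  refine ⟨p + 1, hbound.trans ((hlog.mul ((rpow_mul_Gamma_isBigO three_pos).add
    (rpow_mul_Gamma_isBigO one_pos))).congr_right fun s => ?_)⟩
  ring

theorem HasLogExpansion.isSoftBigO_integral (h : HasLogExpansion F W) :
    IsSoftBigO (𝓝[>] 0) Real.log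
      (fun s => ∫ v, F (⌊v / s⌋₊ + 1) ∂expMeasure 1 -
        (rho (W.comp (X - C Real.eulerMascheroniConstant))).eval (-Real.log s)) fun s => s := by
  set V := W.comp (X - C Real.eulerMascheroniConstant) with hV
  refine h.isSoftBigO_floor.integral_comp_div.congr_left ?_
  filter_upwards [self_mem_nhdsWithin] with s hs
  have eval_V : (fun v => V.eval (-Real.log s + shiftedLog v)) =ᵐ[expMeasure 1]
      fun v => W.eval (Real.log (v / s)) := by
    filter_upwards [ae_pos_expMeasure_one] with v hv
    rw [hV, eval_comp, Real.log_div hv.ne' (ne_of_gt hs), shiftedLog, eval_sub, eval_X, eval_C]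
    congr 1
    ring
  have hW : Integrable (fun v => W.eval (Real.log (v / s))) (expMeasure 1) :=
    (integrable_eval_add_shiftedLog V (-Real.log s)).congr eval_V
  have hF : Integrable (fun v => F (⌊v / s⌋₊ + 1)) (expMeasure 1) := by
    have hmeas : Measurable fun u : ℝ => F (⌊u⌋₊ + 1) - W.eval (Real.log u) :=
      ((measurable_from_nat (f := fun n => F (n + 1))).comp Nat.measurable_floor).sub
        (W.continuous.measurable.comp Real.measurable_log)
    exact ((h.isSoftBigO_floor.integrable_comp_div hmeas hs).add hW).congr
      (ae_of_all _ fun v => sub_add_cancel _ _)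
  rw [eval_rho, integral_congr_ae eval_V, integral_sub hF hW]

end Laplace

section Transfer

theorem tendsto_one_sub_nhdsLT_one : Tendsto (fun t : ℝ => 1 - t) (𝓝[<] 1) (𝓝[>] 0) := by
  refine tendsto_nhdsWithin_iff.2 ⟨?_, ?_⟩
  · have h : Tendsto (fun t : ℝ => 1 - t) (𝓝 1) (𝓝 (1 - 1)) :=
      (continuous_const.sub continuous_id).tendsto 1
    rw [sub_self] at h
    exact h.mono_left nhdsWithin_le_nhds
  · filter_upwards [self_mem_nhdsWithin] with t ht
    exact sub_pos.2 (mem_Iio.1 ht)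

theorem tendsto_neg_log_one_sub :
    Tendsto (fun t : ℝ => -Real.log (1 - t)) (𝓝[<] 1) atTop :=
  tendsto_neg_atBot_atTop.comp (Real.tendsto_log_nhdsGT_zero.comp tendsto_one_sub_nhdsLT_one)

theorem eventually_one_le_abs_log_one_sub : ∀ᶠ t in 𝓝[<] (1 : ℝ), 1 ≤ |Real.log (1 - t)| :=
  (tendsto_neg_log_one_sub.eventually_ge_atTop 1).mono fun _ h => h.trans (neg_le_abs _)

theorem one_sub_isBigO_one : (fun t : ℝ => 1 - t) =O[𝓝[<] 1] fun _ => (1 : ℝ) :=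
  (tendsto_nhds_of_tendsto_nhdsWithin tendsto_one_sub_nhdsLT_one).isBigO_one ℝ

theorem isBigO_one_sub_of_hasDerivAt {f : ℝ → ℝ} {f' : ℝ} (hf : HasDerivAt f f' 1) :
    (fun t => f t - f 1) =O[𝓝[<] 1] fun t => 1 - t := by
  have h := hf.isBigO_sub.mono (nhdsWithin_le_nhds (s := Iio 1))
  simpa only [neg_sub] using h.neg_right

theorem rpow_sub_one_isBigO_one_sub (x : ℝ) :
    (fun t : ℝ => t ^ x - 1) =O[𝓝[<] 1] fun t => 1 - t := by
  simpa only [Real.one_rpow] using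
    isBigO_one_sub_of_hasDerivAt (Real.hasDerivAt_rpow_const (p := x) (.inl one_ne_zero))

theorem neg_log_isBigO_one_sub : (fun t => -Real.log t) =O[𝓝[<] 1] fun t => 1 - t := by
  simpa only [Real.log_one, sub_zero] using
    (isBigO_one_sub_of_hasDerivAt (Real.hasDerivAt_log one_ne_zero)).neg_left

theorem eventually_mem_Ioo_nhdsLT_one : ∀ᶠ t in 𝓝[<] (1 : ℝ), t ∈ Ioo 0 1 :=
  Ioo_mem_nhdsLT one_pos

theorem tendsto_neg_log_nhdsLT_one : Tendsto (fun t => -Real.log t) (𝓝[<] 1) (𝓝[>] 0) := by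
  refine tendsto_nhdsWithin_iff.2 ⟨?_, ?_⟩
  · exact neg_log_isBigO_one_sub.trans_tendsto
      (tendsto_nhds_of_tendsto_nhdsWithin tendsto_one_sub_nhdsLT_one)
  · filter_upwards [eventually_mem_Ioo_nhdsLT_one] with t ht
    exact neg_pos.2 (Real.log_neg ht.1 ht.2)

theorem log_neg_log_sub_log_one_sub_isBigO :
    (fun t => Real.log (-Real.log t) - Real.log (1 - t)) =O[𝓝[<] 1] fun t => 1 - t := by
  refine IsBigO.trans (IsBigO.of_bound' ?_) neg_log_isBigO_one_sub
  filter_upwards [eventually_mem_Ioo_nhdsLT_one] with t ⟨ht₀, ht₁⟩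
  have hε : 0 < 1 - t := sub_pos.2 ht₁
  have hlower : 1 - t ≤ -Real.log t := by linarith [Real.log_le_sub_one_of_pos ht₀]
  have hupper : -Real.log t ≤ (1 - t) / t := by
    rw [sub_div, div_self ht₀.ne', one_div]
    linarith [Real.one_sub_inv_le_log_of_pos ht₀]
  have hlog : Real.log (-Real.log t) ≤ Real.log (1 - t) - Real.log t := by
    rw [← Real.log_div hε.ne' ht₀.ne']
    exact Real.log_le_log (hε.trans_le hlower) hupper
  rw [Real.norm_of_nonneg (sub_nonneg.2 (Real.log_le_log hε hlower)),
    Real.norm_of_nonneg (hε.le.trans hlower)]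
  linarith

theorem log_neg_log_isBigO_log_one_sub :
    (fun t => Real.log (-Real.log t)) =O[𝓝[<] 1] fun t => Real.log (1 - t) := by
  have hone : (fun _ => (1 : ℝ)) =O[𝓝[<] 1] fun t => Real.log (1 - t) :=
    IsBigO.of_bound' (eventually_one_le_abs_log_one_sub.mono fun t ht => by
      rwa [norm_one])
  simpa only [sub_add_cancel] using ((log_neg_log_sub_log_one_sub_isBigO.trans
    one_sub_isBigO_one).trans hone).add (isBigO_refl (fun t => Real.log (1 - t)) _)

theorem isSoftBigO_one_sub_of_neg_log {I : ℝ → ℝ} {P : ℝ[X]} (x : ℝ)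
    (h : IsSoftBigO (𝓝[>] 0) Real.log (fun s => I s - P.eval (-Real.log s)) fun s => s) :
    IsSoftBigO (𝓝[<] 1) (fun t => Real.log (1 - t))
      (fun t => t ^ x * I (-Real.log t) - P.eval (-Real.log (1 - t))) fun t => 1 - t := by
  have hL := eventually_one_le_abs_log_one_sub
  have hM := log_neg_log_isBigO_log_one_sub.neg_left
  have hΛ := (isBigO_refl (fun t => Real.log (1 - t)) (𝓝[<] 1)).neg_left
  have hmain : IsSoftBigO (𝓝[<] 1) (fun t => Real.log (1 - t))
      (fun t => t ^ x * (I (-Real.log t) - P.eval (-Real.log (-Real.log t)))) fun t => 1 - t := by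
    have hpow : (fun t : ℝ => t ^ x) =O[𝓝[<] 1] fun _ => (1 : ℝ) := by
      simpa only [sub_add_cancel] using
        ((rpow_sub_one_isBigO_one_sub x).trans one_sub_isBigO_one).add (isBigO_refl _ _)
    simpa only [one_mul, Function.comp_def] using (IsSoftBigO.of_isBigO hpow).mul
      (((h.comp_tendsto tendsto_neg_log_nhdsLT_one).of_gauge_isBigO
        log_neg_log_isBigO_log_one_sub).trans (.of_isBigO neg_log_isBigO_one_sub))
  have hfactor : IsSoftBigO (𝓝[<] 1) (fun t => Real.log (1 - t))
      (fun t => (t ^ x - 1) * P.eval (-Real.log (-Real.log t))) fun t => 1 - t := by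
    simpa only [mul_one] using
      (IsSoftBigO.of_isBigO (rpow_sub_one_isBigO_one_sub x)).mul (isSoftBigO_eval P hM hL)
  have hshift : IsSoftBigO (𝓝[<] 1) (fun t => Real.log (1 - t))
      (fun t => P.eval (-Real.log (-Real.log t)) - P.eval (-Real.log (1 - t))) fun t => 1 - t := by
    refine (isSoftBigO_eval_sub_eval P hM hΛ hL).trans (.of_isBigO ?_)
    simpa only [neg_sub', neg_neg] using log_neg_log_sub_log_one_sub_isBigO.neg_left
  refine ((hmain.add hfactor hL).add hshift hL).congr_left (.of_forall fun t => ?_)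
  ring

end Transfer

section Regularization

theorem eq_zero_of_tendsto_eval {α : Type*} {l : Filter α} [l.NeBot] {f : α → ℝ} {Q : ℝ[X]}
    (hf : Tendsto f l atTop) (hQ : Tendsto (fun a => Q.eval (f a)) l (𝓝 0)) : Q = 0 := by
  by_cases hdeg : 0 < Q.degree
  · exact absurd hQ.abs (not_tendsto_nhds_of_tendsto_atTop ((Q.abs_tendsto_atTop hdeg).comp hf) _)
  · obtain ⟨c, rfl⟩ : ∃ c, Q = C c := ⟨_, eq_C_of_degree_le_zero (not_lt.1 hdeg)⟩
    simp only [eval_C] at hQ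
    rw [tendsto_nhds_unique tendsto_const_nhds hQ, map_zero]

theorem eq_of_isBigO_sub_eval {α : Type*} {l : Filter α} [l.NeBot] {f F g h : α → ℝ} {P Q : ℝ[X]}
    (hf : Tendsto f l atTop) (hP : (fun a => F a - P.eval (f a)) =O[l] g)
    (hQ : (fun a => F a - Q.eval (f a)) =O[l] h) (hg : Tendsto g l (𝓝 0))
    (hh : Tendsto h l (𝓝 0)) : P = Q := by
  rw [← sub_eq_zero]
  refine eq_zero_of_tendsto_eval hf ?_
  simpa only [eval_sub, sub_sub_sub_cancel_left, sub_zero] using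
    (hQ.trans_tendsto hh).sub (hP.trans_tendsto hg)

theorem tendsto_one_sub_mul_log_pow (p : ℕ) :
    Tendsto (fun t : ℝ => (1 - t) * Real.log (1 - t) ^ p) (𝓝[<] 1) (𝓝 0) := by
  have h := (((tendsto_inv_mul_log_pow p).comp tendsto_inv_nhdsGT_zero).comp
    tendsto_one_sub_nhdsLT_one).const_mul ((-1) ^ p)
  rw [mul_zero] at h
  refine h.congr fun t => ?_
  simp only [Function.comp, inv_inv, Real.log_inv]
  rw [mul_left_comm, ← mul_pow, neg_one_mul, neg_neg]

variable {x : ℝ} {r : ℕ} {k : Fin r → ℕ+}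

theorem IsSeriesReg.unique {Z Z' : ℝ[X]} (h : IsSeriesReg x k Z) (h' : IsSeriesReg x k Z') :
    Z = Z' := by
  obtain ⟨p, -, h⟩ := h
  obtain ⟨q, -, h'⟩ := h'
  exact eq_of_isBigO_sub_eval (tendsto_atTop_add_const_right _ _ tendsto_log_natCast_atTop) h h'
    ((tendsto_inv_mul_log_pow p).comp tendsto_natCast_atTop_atTop)
    ((tendsto_inv_mul_log_pow q).comp tendsto_natCast_atTop_atTop)

theorem IsIntegralReg.unique {P P' : ℝ[X]} (h : IsIntegralReg x k P)
    (h' : IsIntegralReg x k P') : P = P' := by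
  obtain ⟨p, -, h⟩ := h
  obtain ⟨q, -, h'⟩ := h'
  exact eq_of_isBigO_sub_eval tendsto_neg_log_one_sub h h' (tendsto_one_sub_mul_log_pow p)
    (tendsto_one_sub_mul_log_pow q)

theorem HasLogExpansion.isSeriesReg {W : ℝ[X]} (h : HasLogExpansion (zetaTrunc x k) W) :
    IsSeriesReg x k (W.comp (X + C (digamma (1 + x)))) := by
  simpa only [IsSeriesReg, eval_comp, eval_add, eval_X, eval_C, sub_add_cancel] using
    h.exists_pos eventually_one_le_abs_log_natCast

theorem HasLogExpansion.isIntegralReg (hx : -1 < x) {k : Fin (r + 1) → ℕ+} {W : ℝ[X]}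
    (h : HasLogExpansion (zetaTrunc x k) W) :
    IsIntegralReg x k (rho (W.comp (X - C Real.eulerMascheroniConstant))) := by
  refine ((isSoftBigO_one_sub_of_neg_log x h.isSoftBigO_integral).congr_left ?_).exists_pos
    eventually_one_le_abs_log_one_sub
  filter_upwards [eventually_mem_Ioo_nhdsLT_one] with t ht
  have hLi := hurwitzLi_exp_neg hx k (neg_pos.2 (Real.log_neg ht.1 ht.2))
  rw [neg_neg, Real.exp_log ht.1] at hLi
  rw [hLi]

theorem isIntegralReg_one (x : ℝ) (k : Fin 0 → ℕ+) : IsIntegralReg x k 1 :=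
  ⟨1, one_pos, by simpa only [hurwitzLi, eval_one, sub_self] using isBigO_zero _ _⟩

theorem exists_isSeriesReg_isIntegralReg (hx : -1 < x) (k : Fin r → ℕ+) : ∃ W : ℝ[X],
    IsSeriesReg x k (W.comp (X + C (digamma (1 + x)))) ∧
      IsIntegralReg x k (rho (W.comp (X - C Real.eulerMascheroniConstant))) := by
  rcases r with _ | r
  · exact ⟨1, (hasLogExpansion_zetaTrunc_zero x k).isSeriesReg,
      by simpa only [one_comp, rho_one] using isIntegralReg_one x k⟩
  · obtain ⟨W, hW⟩ := exists_hasLogExpansion_zetaTrunc x k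
    exact ⟨W, hW.isSeriesReg, hW.isIntegralReg hx⟩

theorem IsSeriesReg.seriesRegPoly_eq {Z : ℝ[X]} (h : IsSeriesReg x k Z) : seriesRegPoly x k = Z :=
  (Classical.epsilon_spec ⟨Z, h⟩ : IsSeriesReg x k (seriesRegPoly x k)).unique h

theorem IsIntegralReg.integralRegPoly_eq {P : ℝ[X]} (h : IsIntegralReg x k P) :
    integralRegPoly x k = P :=
  (Classical.epsilon_spec ⟨P, h⟩ : IsIntegralReg x k (integralRegPoly x k)).unique h

end Regularization

end HurwitzMZV

theorem theorem2p2_general (x : ℝ) (hx : -1 < x) {r : ℕ} (k : Fin r → ℕ+) :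
    (∃! Z : Polynomial ℝ, HurwitzMZV.IsSeriesReg x k Z) ∧
    (∃! P : Polynomial ℝ, HurwitzMZV.IsIntegralReg x k P) ∧
    HurwitzMZV.integralRegPoly x k =
      HurwitzMZV.rho ((HurwitzMZV.seriesRegPoly x k).comp
        (Polynomial.X - Polynomial.C Real.eulerMascheroniConstant
          - Polynomial.C (HurwitzMZV.digamma (1 + x)))) := by
  obtain ⟨W, hZ, hP⟩ := HurwitzMZV.exists_isSeriesReg_isIntegralReg hx k
  refine ⟨⟨_, hZ, fun Z h => h.unique hZ⟩, ⟨_, hP, fun P h => h.unique hP⟩, ?_⟩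
  rw [hP.integralRegPoly_eq, hZ.seriesRegPoly_eq, Polynomial.comp_assoc, Polynomial.add_comp,
    Polynomial.X_comp, Polynomial.C_comp, sub_add_cancel]

theorem theorem2p2 (x : ℝ) (hx : |x| < 1) {r : ℕ} (k : Fin r → ℕ+) :
    (∃! Z : Polynomial ℝ, HurwitzMZV.IsSeriesReg x k Z) ∧
    (∃! P : Polynomial ℝ, HurwitzMZV.IsIntegralReg x k P) ∧
    HurwitzMZV.integralRegPoly x k =
      HurwitzMZV.rho ((HurwitzMZV.seriesRegPoly x k).comp
        (Polynomial.X - Polynomial.C Real.eulerMascheroniConstant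
          - Polynomial.C (HurwitzMZV.digamma (1 + x)))) :=
  theorem2p2_general x (abs_lt.1 hx).1 k
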